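/- Let $p\ge 3$ and $n\ge 0$ be integers, and let $\eta=(1,0,\dots,0)\in\mathbb R^p$. For $d\ge 0$ let $\Omega_d$ denote the surface area of the unit sphere $S^d=\{x\in\mathbb R^{d+1}:|x|=1\}$ (so $\Omega_0=2$, $\Omega_1=2\pi$). A real polynomial $P$ in one variable is called a $p$-dimensional Legendre polynomial of degree $n$ if there is a homogeneous polynomial $L$ of degree $n$ in $p$ real variables, harmonic in the sense that $\sum_{j=1}^p \partial^2L/\partial x_j^2=0$, such that $L(\eta)=1$, $L(Rx)=L(x)$ for all $x\in\mathbb R^p$ and all real matrices $R$ with $R^{t}R=I$ and $R\eta=\eta$, and $L(\xi)=P(\langle\xi,\eta\rangle)$ for all $\xi\in\mathbb R^p$ with $|\xi|=1$. Theorem. There is exactly one such polynomial, denoted $P_n$, and for every $t\in[-1,1]$ the following integral converges absolutely and \[ P_n(t)=\frac{\Omega_{p-3}}{\Omega_{p-2}}\int_{-1}^{1}\left(t+is\sqrt{1-t^2}\right)^n(1-s^2)^{(p-4)/2}\,ds . \] -/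

import Mathlib

open MeasureTheory

/-- The surface area `Ω_d` of the unit `d`-sphere `S^d ⊂ ℝ^(d+1)`: the total mass of the surface
measure on the unit sphere of Euclidean space induced by Lebesgue measure. -/
noncomputable def sphereArea (d : ℕ) : ℝ :=
  ((volume : Measure (EuclideanSpace ℝ (Fin (d + 1)))).toSphere).real Set.univ

/-- The vector `η = (1, 0, …, 0)` of `ℝ^p`. -/
def poleVec (p : ℕ) : Fin p → ℝ := fun i => if (i : ℕ) = 0 then 1 else 0

/-- The Laplace operator `Δ_p = ∑ ∂²/∂x_i²` on polynomials in `p` variables. -/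
noncomputable def polyLaplacian (p : ℕ) (L : MvPolynomial (Fin p) ℝ) : MvPolynomial (Fin p) ℝ :=
  ∑ i : Fin p, MvPolynomial.pderiv i (MvPolynomial.pderiv i L)

/-- `L` is a harmonic homogeneous polynomial of degree `n` in `p` variables with `L(η) = 1` and
`L(Rx) = L(x)` for every rotation matrix `R` (`RᵀR = 1`) such that `Rη = η`. -/
structure IsZonalHarmonic (p n : ℕ) (L : MvPolynomial (Fin p) ℝ) : Prop where
  homogeneous : L.IsHomogeneous n
  harmonic : polyLaplacian p L = 0
  eval_pole : MvPolynomial.eval (poleVec p) L = 1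
  invariant : ∀ R ∈ Matrix.orthogonalGroup (Fin p) ℝ, R.mulVec (poleVec p) = poleVec p →
    ∀ x : Fin p → ℝ, MvPolynomial.eval (R.mulVec x) L = MvPolynomial.eval x L

/-- `P` is the `p`-dimensional Legendre polynomial of degree `n`: the restriction to the unit
sphere of the polynomial `L_n` above, `L_n(ξ)`, written in terms of the variable `t = ⟨ξ, η⟩`. -/
def IsLegendrePolynomial (p n : ℕ) (P : Polynomial ℝ) : Prop :=
  ∃ L : MvPolynomial (Fin p) ℝ, IsZonalHarmonic p n L ∧
    ∀ ξ : Fin p → ℝ, dotProduct ξ ξ = 1 →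
      MvPolynomial.eval ξ L = P.eval (dotProduct ξ (poleVec p))

/-- The integrand `(t + i s √(1 - t²))^n (1 - s²)^((p - 4)/2)`. -/
noncomputable def laplaceIntegrand (p n : ℕ) (t s : ℝ) : ℂ :=
  ((t : ℂ) + Complex.I * (s : ℂ) * (Real.sqrt (1 - t ^ 2) : ℂ)) ^ n *
    (((1 - s ^ 2) ^ (((p : ℝ) - 4) / 2) : ℝ) : ℂ)

/-!
# The Laplace integral representation of Legendre polynomials

Write `x = (x₀, y)` with `x₀` the coordinate along the pole. Householder reflections fixing the pole
show that the value of a zonal form at `x` depends only on `x₀` and `|x|`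
(`IsZonalHarmonic.eval_eq`). Restricted to the points `(1, r, 0, …, 0)` such a form is therefore an
even polynomial in `r`, and by homogeneity the form is `∑ c_k x₀^(n-2k) |y|^(2k)`
(`IsZonalHarmonic.exists_eq_axialForm`). On forms of this shape (`axialForm`) the Laplace equation in
dimension `p` is the recursion
`(n-2k)(n-2k-1) c_k + 2(k+1)(2k+p-1) c_(k+1) = 0`
(`polyLaplacian_axialForm`, `coeff_succ_of_polyLaplacian_eq_zero`), so `c_0 = 1` determines all
coefficients.

With `q = p - 3`, the substitution `s = cos θ` turns the integral of the theorem into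
`∫₀^π (t + i cos θ √(1-t²))^n sin^q θ dθ`, whose integrand is continuous; this gives both convergence
and the value. In the binomial expansion the odd moments of `cos` vanish, and the result is
`∑ c_k t^(n-2k) (1-t²)^k` up to the factor `∫₀^π sin^q`, with
`c_k = (-1)^k (n choose 2k) ∫₀^π cos^(2k) sin^q / ∫₀^π sin^q` (`zonalCoeff`,
`integral_trigIntegrand`). Integration by parts (`trigMoment_add_two`) shows that these `c_k` satisfy
the recursion above, so that the integral is the restriction of the zonal harmonic to the sphere.
Finally `∫₀^π sin^q` is the ratio of the areas of the spheres of dimensions `q + 1` and `q`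
(`sphereArea_succ`).
-/

/-! ### Trigonometric moments and sphere areas -/

/-- The moment `∫₀^π cos^j θ sin^q θ dθ`. -/
noncomputable def trigMoment (q j : ℕ) : ℝ :=
  ∫ θ in (0 : ℝ)..Real.pi, Real.cos θ ^ j * Real.sin θ ^ q

/-- Integration of the derivative of `cos^(j+1) sin^(q+1)` over `[0, π]`. -/
theorem trigMoment_add_two (q j : ℕ) :
    ((j : ℝ) + q + 2) * trigMoment q (j + 2) = (j + 1) * trigMoment q j := by
  have hd : ∀ θ ∈ Set.uIcc (0 : ℝ) Real.pi,
      HasDerivAt (fun x => Real.cos x ^ (j + 1) * Real.sin x ^ (q + 1))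
        (((j : ℝ) + q + 2) * (Real.cos θ ^ (j + 2) * Real.sin θ ^ q)
          - (j + 1) * (Real.cos θ ^ j * Real.sin θ ^ q)) θ := by
    intro θ _
    have h := ((Real.hasDerivAt_cos θ).pow (j + 1)).mul ((Real.hasDerivAt_sin θ).pow (q + 1))
    refine h.congr_deriv ?_
    have hs : Real.sin θ * Real.sin θ = 1 - Real.cos θ ^ 2 := by
      rw [← Real.sin_sq_add_cos_sq θ]; ring
    push_cast [Nat.add_sub_cancel, Pi.pow_apply]
    linear_combination (-(j + 1 : ℝ) * Real.cos θ ^ j * Real.sin θ ^ q) * hs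
  have hi := intervalIntegral.integral_eq_sub_of_hasDerivAt hd
    (Continuous.intervalIntegrable (by fun_prop) _ _)
  rw [intervalIntegral.integral_sub (Continuous.intervalIntegrable (by fun_prop) _ _)
    (Continuous.intervalIntegrable (by fun_prop) _ _), intervalIntegral.integral_const_mul,
    intervalIntegral.integral_const_mul] at hi
  simp only [Real.sin_pi, Real.sin_zero, ne_eq, Nat.succ_ne_zero, not_false_eq_true, zero_pow,
    mul_zero, sub_zero] at hi
  unfold trigMoment
  linarith

theorem trigMoment_odd (q k : ℕ) : trigMoment q (2 * k + 1) = 0 := by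
  induction k with
  | zero =>
    have hd : ∀ θ ∈ Set.uIcc (0 : ℝ) Real.pi, HasDerivAt (fun x => Real.sin x ^ (q + 1))
        (((q : ℝ) + 1) * (Real.cos θ ^ (2 * 0 + 1) * Real.sin θ ^ q)) θ := by
      intro θ _
      refine ((Real.hasDerivAt_sin θ).pow (q + 1)).congr_deriv ?_
      push_cast [Nat.add_sub_cancel]
      ring
    have hi := intervalIntegral.integral_eq_sub_of_hasDerivAt hd
      (Continuous.intervalIntegrable (by fun_prop) _ _)
    rw [intervalIntegral.integral_const_mul] at hi
    simp only [Real.sin_pi, Real.sin_zero, ne_eq, Nat.succ_ne_zero, not_false_eq_true, zero_pow,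
      sub_zero] at hi
    exact (mul_eq_zero.1 hi).resolve_left (by positivity)
  | succ k ih =>
    have h := trigMoment_add_two q (2 * k + 1)
    rw [ih, mul_zero] at h
    exact (mul_eq_zero.1 h).resolve_left (by positivity)

theorem trigMoment_zero_pos (q : ℕ) : 0 < trigMoment q 0 := by
  simpa [trigMoment] using integral_sin_pow_pos (n := q)

theorem sphereArea_eq (d : ℕ) :
    sphereArea d = (d + 1) * (√Real.pi ^ (d + 1) / Real.Gamma (((d : ℝ) + 1) / 2 + 1)) := by
  have hG : 0 < Real.Gamma (((d : ℝ) + 1) / 2 + 1) := Real.Gamma_pos_of_pos (by positivity)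
  rw [sphereArea, Measure.toSphere_real_apply_univ, measureReal_def, EuclideanSpace.volume_ball]
  simp only [finrank_euclideanSpace, Fintype.card_fin, ENNReal.ofReal_one, one_pow, one_mul]
  push_cast
  rw [ENNReal.toReal_ofReal (by positivity)]

theorem sphereArea_add_two (d : ℕ) :
    sphereArea (d + 2) = 2 * Real.pi / (d + 1) * sphereArea d := by
  have hG : 0 < Real.Gamma (((d : ℝ) + 1) / 2 + 1) := Real.Gamma_pos_of_pos (by positivity)
  have h : Real.Gamma ((((d + 2 : ℕ) : ℝ) + 1) / 2 + 1)
      = (((d : ℝ) + 1) / 2 + 1) * Real.Gamma (((d : ℝ) + 1) / 2 + 1) := by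
    rw [← Real.Gamma_add_one (by positivity)]
    congr 1
    push_cast
    ring
  rw [sphereArea_eq, sphereArea_eq, h, show d + 2 + 1 = d + 1 + 2 by ring, pow_add, Real.sq_sqrt Real.pi_pos.le]
  push_cast
  field_simp
  ring

theorem sphereArea_pos (d : ℕ) : 0 < sphereArea d := by
  have hG : 0 < Real.Gamma (((d : ℝ) + 1) / 2 + 1) := Real.Gamma_pos_of_pos (by positivity)
  have := Real.pi_pos
  rw [sphereArea_eq]
  positivity

theorem sphereArea_zero : sphereArea 0 = 2 := by
  have h : Real.Gamma (1 / 2 + 1) = 1 / 2 * √Real.pi := by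
    rw [Real.Gamma_add_one (by norm_num), Real.Gamma_one_half_eq]
  have := Real.pi_pos
  rw [sphereArea_eq]
  norm_num
  norm_num at h
  rw [h]
  field_simp

theorem sphereArea_one : sphereArea 1 = 2 * Real.pi := by
  rw [sphereArea_eq]
  norm_num [Real.sq_sqrt Real.pi_pos.le, Real.Gamma_two]

/-- The total mass of the weight `sin^q` is the ratio of consecutive sphere areas: both sides are
multiplied by `(q+1)/(q+2)` when `q` grows by two. -/
theorem sphereArea_succ (q : ℕ) : sphereArea (q + 1) = trigMoment q 0 * sphereArea q := by
  induction q using Nat.twoStepInduction with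
  | zero => simp [trigMoment, sphereArea_zero, sphereArea_one]; ring
  | one =>
    rw [sphereArea_add_two 0, sphereArea_one, sphereArea_zero]
    norm_num [trigMoment]
    ring
  | more q ih _ =>
    have h : trigMoment (q + 2) 0 = (q + 1) / (q + 2) * trigMoment q 0 := by
      simp only [trigMoment, pow_zero, one_mul]
      rw [integral_sin_pow]
      simp
    rw [sphereArea_add_two (q + 1), ih, sphereArea_add_two q, h]
    push_cast
    field_simp
    ring

/-! ### The Laplace integral -/

theorem image_cos_Ioo : Real.cos '' Set.Ioo 0 Real.pi = Set.Ioo (-1) 1 := by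
  ext s
  constructor
  · rintro ⟨θ, ⟨h0, hπ⟩, rfl⟩
    constructor
    · simpa using Real.strictAntiOn_cos ⟨h0.le, hπ.le⟩ ⟨Real.pi_pos.le, le_rfl⟩ hπ
    · simpa using Real.strictAntiOn_cos ⟨le_rfl, Real.pi_pos.le⟩ ⟨h0.le, hπ.le⟩ h0
  · rintro ⟨h1, h2⟩
    exact ⟨Real.arccos s, ⟨Real.arccos_pos.2 h2, Real.arccos_lt_pi.2 h1⟩,
      Real.cos_arccos h1.le h2.le⟩

/-- The Laplace integrand of dimension `q + 3` after the substitution `s = cos θ`. -/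
noncomputable def trigIntegrand (q n : ℕ) (t θ : ℝ) : ℂ :=
  ((t : ℂ) + Complex.I * (Real.cos θ : ℂ) * (√(1 - t ^ 2) : ℂ)) ^ n * ((Real.sin θ ^ q : ℝ) : ℂ)

theorem continuous_trigIntegrand (q n : ℕ) (t : ℝ) : Continuous (trigIntegrand q n t) := by
  unfold trigIntegrand
  fun_prop

/-- The Jacobian `sin θ` turns the singular weight `(1 - s²)^((q-1)/2)` into `sin^q θ`. -/
theorem sin_smul_laplaceIntegrand_cos (q n : ℕ) (t : ℝ) {θ : ℝ} (hθ : θ ∈ Set.Ioo 0 Real.pi) :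
    |-Real.sin θ| • laplaceIntegrand (q + 3) n t (Real.cos θ) = trigIntegrand q n t θ := by
  have hs : 0 < Real.sin θ := Real.sin_pos_of_mem_Ioo hθ
  have h : Real.sin θ * (1 - Real.cos θ ^ 2) ^ ((((q + 3 : ℕ) : ℝ) - 4) / 2)
      = Real.sin θ ^ q := by
    rw [← Real.sin_sq, ← Real.rpow_natCast_mul hs.le]
    nth_rewrite 1 [← Real.rpow_one (Real.sin θ)]
    rw [← Real.rpow_add hs, ← Real.rpow_natCast]
    congr 1
    push_cast
    ring
  rw [abs_neg, abs_of_pos hs, Complex.real_smul, laplaceIntegrand, trigIntegrand, ← h]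
  push_cast
  ring

theorem intervalIntegrable_laplaceIntegrand (q n : ℕ) (t : ℝ) :
    IntervalIntegrable (laplaceIntegrand (q + 3) n t) volume (-1) 1 := by
  rw [intervalIntegrable_iff_integrableOn_Ioo_of_le (by norm_num), ← image_cos_Ioo,
    integrableOn_image_iff_integrableOn_abs_deriv_smul measurableSet_Ioo
      (fun θ _ => (Real.hasDerivAt_cos θ).hasDerivWithinAt)
      (Real.injOn_cos.mono Set.Ioo_subset_Icc_self),
    integrableOn_congr_fun (fun θ hθ => sin_smul_laplaceIntegrand_cos q n t hθ) measurableSet_Ioo]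
  exact ((continuous_trigIntegrand q n t).integrableOn_Icc).mono_set Set.Ioo_subset_Icc_self

theorem integral_laplaceIntegrand (q n : ℕ) (t : ℝ) :
    ∫ s in (-1 : ℝ)..1, laplaceIntegrand (q + 3) n t s
      = ∫ θ in (0 : ℝ)..Real.pi, trigIntegrand q n t θ := by
  rw [intervalIntegral.integral_of_le (by norm_num), intervalIntegral.integral_of_le
    Real.pi_pos.le, integral_Ioc_eq_integral_Ioo, integral_Ioc_eq_integral_Ioo, ← image_cos_Ioo,
    integral_image_eq_integral_abs_deriv_smul measurableSet_Ioo
      (fun θ _ => (Real.hasDerivAt_cos θ).hasDerivWithinAt)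
      (Real.injOn_cos.mono Set.Ioo_subset_Icc_self)]
  exact setIntegral_congr_fun measurableSet_Ioo
    fun θ hθ => sin_smul_laplaceIntegrand_cos q n t hθ

theorem sum_range_eq_sum_even {M : Type*} [AddCommMonoid M] (g : ℕ → M)
    (hg : ∀ k, g (2 * k + 1) = 0) (n : ℕ) :
    ∑ j ∈ Finset.range (n + 1), g j = ∑ k ∈ Finset.range (n / 2 + 1), g (2 * k) := by
  induction n with
  | zero => simp
  | succ n ih =>
    rw [Finset.sum_range_succ, ih]
    rcases Nat.even_or_odd' n with ⟨k, rfl | rfl⟩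
    · rw [hg, add_zero, show (2 * k + 1) / 2 = 2 * k / 2 by omega]
    · rw [show (2 * k + 1 + 1) / 2 = (2 * k + 1) / 2 + 1 by omega,
        Finset.sum_range_succ _ ((2 * k + 1) / 2 + 1)]
      congr 2
      omega

/-- The coefficient of `x₀^(n-2k) |y|^(2k)` in the zonal harmonic of degree `n` in dimension
`q + 3`, where `x = (x₀, y)`. -/
noncomputable def zonalCoeff (q n k : ℕ) : ℝ :=
  (-1) ^ k * n.choose (2 * k) * (trigMoment q (2 * k) / trigMoment q 0)

/-- Binomial expansion of the power; the odd moments of the weight vanish. -/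
theorem integral_trigIntegrand (q n : ℕ) {t : ℝ} (ht : t ∈ Set.Icc (-1 : ℝ) 1) :
    ∫ θ in (0 : ℝ)..Real.pi, trigIntegrand q n t θ
      = ((trigMoment q 0 * ∑ k ∈ Finset.range (n / 2 + 1),
          zonalCoeff q n k * t ^ (n - 2 * k) * (1 - t ^ 2) ^ k : ℝ) : ℂ) := by
  have hexp : ∀ θ, trigIntegrand q n t θ = ∑ j ∈ Finset.range (n + 1),
      ((Complex.I * (√(1 - t ^ 2) : ℂ)) ^ j * (t : ℂ) ^ (n - j) * (n.choose j : ℂ)) *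
        ((Real.cos θ ^ j * Real.sin θ ^ q : ℝ) : ℂ) := by
    intro θ
    rw [trigIntegrand, add_comm (t : ℂ), add_pow, Finset.sum_mul]
    refine Finset.sum_congr rfl fun j _ => ?_
    push_cast
    ring
  simp_rw [hexp]
  rw [intervalIntegral.integral_finsetSum
    (fun j _ => Continuous.intervalIntegrable (by fun_prop) _ _)]
  simp_rw [intervalIntegral.integral_const_mul, intervalIntegral.integral_ofReal]
  change ∑ j ∈ Finset.range (n + 1), _ * ((trigMoment q j : ℝ) : ℂ) = _
  rw [sum_range_eq_sum_even _ (fun k => by rw [trigMoment_odd]; simp), Finset.mul_sum]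
  push_cast
  refine Finset.sum_congr rfl fun k _ => ?_
  have h0 : (trigMoment q 0 : ℂ) ≠ 0 := by exact_mod_cast (trigMoment_zero_pos q).ne'
  have hu : (√(1 - t ^ 2) : ℂ) ^ 2 = 1 - (t : ℂ) ^ 2 := by
    exact_mod_cast Real.sq_sqrt (show 0 ≤ 1 - t ^ 2 by nlinarith [ht.1, ht.2])
  rw [zonalCoeff, pow_mul, mul_pow, Complex.I_sq, hu, neg_one_mul, neg_pow]
  push_cast
  field_simp

theorem zonalCoeff_zero (q n : ℕ) : zonalCoeff q n 0 = 1 := by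
  simp [zonalCoeff, (trigMoment_zero_pos q).ne']

theorem zonalCoeff_succ (q n k : ℕ) :
    zonalCoeff q n k * (((n - 2 * k : ℕ) : ℝ) * ((n - 2 * k - 1 : ℕ) : ℝ))
      + zonalCoeff q n (k + 1) * (2 * (k + 1) * (q + 2 + 2 * k)) = 0 := by
  have h0 := (trigMoment_zero_pos q).ne'
  have h1 : (n.choose (2 * k + 1) : ℝ) * (2 * k + 1) = n.choose (2 * k) * ((n - 2 * k : ℕ) : ℝ) := by
    exact_mod_cast Nat.choose_succ_right_eq n (2 * k)
  have h2 : (n.choose (2 * k + 2) : ℝ) * (2 * k + 2)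
      = n.choose (2 * k + 1) * ((n - 2 * k - 1 : ℕ) : ℝ) := by
    have := Nat.choose_succ_right_eq n (2 * k + 1)
    rw [← Nat.sub_sub] at this
    exact_mod_cast this
  have h3 := trigMoment_add_two q (2 * k)
  push_cast at h3
  have h4 : trigMoment q (2 * k + 2)
      = (2 * k + 1) * trigMoment q (2 * k) / (2 * k + q + 2) := by
    rw [eq_div_iff (by positivity)]; linarith
  rw [zonalCoeff, zonalCoeff, show 2 * (k + 1) = 2 * k + 2 by ring, h4, pow_succ]
  field_simp
  linear_combination (-trigMoment q (2 * k) * (-1) ^ k * (2 * k + q + 2)) *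
    ((2 * k + 1 : ℝ) * h2 + ((n - 2 * k - 1 : ℕ) : ℝ) * h1)

/-! ### Axially symmetric forms and their Laplacian -/

open MvPolynomial in
/-- The squared distance `x₁² + ⋯ + x_m²` from the axis spanned by the pole of `ℝ^(m+1)`. -/
noncomputable def axisDistSq (m : ℕ) : MvPolynomial (Fin (m + 1)) ℝ :=
  ∑ i : Fin m, X i.succ ^ 2

open MvPolynomial in
/-- The form `∑ c_k x₀^(n-2k) |y|^(2k)` of degree `n`, where `x = (x₀, y)` and `2k ≤ n`. -/
noncomputable def axialForm (m n : ℕ) (c : ℕ → ℝ) : MvPolynomial (Fin (m + 1)) ℝ :=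
  ∑ k ∈ Finset.range (n / 2 + 1), C (c k) * (X 0 ^ (n - 2 * k) * axisDistSq m ^ k)

theorem dotProduct_poleVec {m : ℕ} (x : Fin (m + 1) → ℝ) : dotProduct x (poleVec (m + 1)) = x 0 := by
  simp [dotProduct, poleVec]

theorem eval_axisDistSq {m : ℕ} (x : Fin (m + 1) → ℝ) :
    MvPolynomial.eval x (axisDistSq m) = dotProduct x x - x 0 ^ 2 := by
  simp [axisDistSq, dotProduct, Fin.sum_univ_succ, pow_two]

theorem eval_axialForm {m n : ℕ} (c : ℕ → ℝ) (x : Fin (m + 1) → ℝ) :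
    MvPolynomial.eval x (axialForm m n c) = ∑ k ∈ Finset.range (n / 2 + 1),
      c k * (x 0 ^ (n - 2 * k) * (dotProduct x x - x 0 ^ 2) ^ k) := by
  simp [axialForm, eval_axisDistSq]

theorem isHomogeneous_axialForm (m n : ℕ) (c : ℕ → ℝ) : (axialForm m n c).IsHomogeneous n := by
  refine MvPolynomial.IsHomogeneous.sum _ _ _ fun k hk => ?_
  have h : (axisDistSq m).IsHomogeneous 2 :=
    MvPolynomial.IsHomogeneous.sum _ _ _ fun i _ => by
      simpa using (MvPolynomial.isHomogeneous_X ℝ i.succ).pow 2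
  have h' := (MvPolynomial.isHomogeneous_C (Fin (m + 1)) (c k)).mul
    (((MvPolynomial.isHomogeneous_X ℝ (0 : Fin (m + 1))).pow (n - 2 * k)).mul (h.pow k))
  rw [Finset.mem_range] at hk
  rwa [show 0 + (1 * (n - 2 * k) + 2 * k) = n by omega] at h'

open MvPolynomial in
theorem pderiv_zero_axisDistSq (m : ℕ) : pderiv 0 (axisDistSq m) = 0 := by
  simp only [axisDistSq, map_sum]
  refine Finset.sum_eq_zero fun i _ => ?_
  rw [Derivation.leibniz_pow, pderiv_X_of_ne (Fin.succ_ne_zero i)]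
  simp

open MvPolynomial in
theorem pderiv_succ_axisDistSq {m : ℕ} (j : Fin m) :
    pderiv j.succ (axisDistSq m) = 2 * X j.succ := by
  simp only [axisDistSq, map_sum]
  rw [Finset.sum_eq_single j]
  · rw [Derivation.leibniz_pow, pderiv_X_self]
    simp
  · intro i _ hij
    rw [Derivation.leibniz_pow, pderiv_X_of_ne (fun h => hij (Fin.succ_injective _ h))]
    simp
  · simp

open MvPolynomial in
theorem pderiv_zero_mul_axisDistSq_pow (m a k : ℕ) :
    pderiv 0 (X 0 ^ a * axisDistSq m ^ k) = (a : MvPolynomial (Fin (m + 1)) ℝ) *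
      (X 0 ^ (a - 1) * axisDistSq m ^ k) := by
  rw [Derivation.leibniz, Derivation.leibniz_pow, Derivation.leibniz_pow,
    pderiv_zero_axisDistSq, pderiv_X_self]
  simp only [smul_eq_mul, nsmul_eq_mul]
  ring

open MvPolynomial in
theorem pderiv_succ_mul_axisDistSq_pow {m : ℕ} (a k : ℕ) (j : Fin m) :
    pderiv j.succ (X 0 ^ a * axisDistSq m ^ k) = (2 * k : MvPolynomial (Fin (m + 1)) ℝ) *
      (X j.succ * (X 0 ^ a * axisDistSq m ^ (k - 1))) := by
  rw [Derivation.leibniz, Derivation.leibniz_pow, Derivation.leibniz_pow,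
    pderiv_succ_axisDistSq, pderiv_X_of_ne (Fin.succ_ne_zero j).symm]
  simp only [smul_eq_mul, nsmul_eq_mul]
  ring

open MvPolynomial in
theorem sum_pderiv_succ_pderiv_succ (m a k : ℕ) :
    ∑ j : Fin m, pderiv j.succ (pderiv j.succ (X 0 ^ a * axisDistSq m ^ (k + 1)))
      = (2 * (k + 1) * (m + 2 * k) : MvPolynomial (Fin (m + 1)) ℝ) *
        (X 0 ^ a * axisDistSq m ^ k) := by
  have h : ∀ j : Fin m, pderiv j.succ (pderiv j.succ (X 0 ^ a * axisDistSq m ^ (k + 1)))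
      = (2 * (k + 1) : MvPolynomial (Fin (m + 1)) ℝ) * (X 0 ^ a * axisDistSq m ^ k)
        + (4 * (k + 1) * k : MvPolynomial (Fin (m + 1)) ℝ) * (X 0 ^ a * axisDistSq m ^ (k - 1)) * X j.succ ^ 2 := by
    intro j
    have hc : (2 * ((k + 1 : ℕ) : MvPolynomial (Fin (m + 1)) ℝ)) = C (2 * ((k + 1 : ℕ) : ℝ)) := by
      rw [C_mul, C_eq_coe_nat, map_ofNat]
    rw [pderiv_succ_mul_axisDistSq_pow, hc, pderiv_C_mul, Derivation.leibniz,
      Nat.add_sub_cancel, pderiv_succ_mul_axisDistSq_pow, pderiv_X_self]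
    simp only [smul_eq_mul, C_mul, C_eq_coe_nat]
    push_cast
    rw [show (C 2 : MvPolynomial (Fin (m + 1)) ℝ) = 2 from map_ofNat C 2]
    ring
  simp_rw [h]
  rw [Finset.sum_add_distrib, ← Finset.mul_sum Finset.univ fun j : Fin m => X j.succ ^ 2]
  change _ + _ * axisDistSq m = _
  rw [Finset.sum_const, Finset.card_univ, Fintype.card_fin, nsmul_eq_mul]
  rcases k with _ | k
  · push_cast; ring
  · rw [Nat.add_sub_cancel]; push_cast; ring

open MvPolynomial in
/-- The Laplacian of an axial form is again an axial form, with one term fewer. -/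
theorem polyLaplacian_axialForm (m n : ℕ) (c : ℕ → ℝ) :
    polyLaplacian (m + 1) (axialForm m n c) = ∑ k ∈ Finset.range (n / 2),
      C (c k * (((n - 2 * k : ℕ) : ℝ) * ((n - 2 * k - 1 : ℕ) : ℝ))
        + c (k + 1) * (2 * (k + 1) * (m + 2 * k))) *
          (X 0 ^ (n - 2 * k - 2) * axisDistSq m ^ k) := by
  have h0 : pderiv 0 (pderiv 0 (axialForm m n c)) = ∑ k ∈ Finset.range (n / 2),
      C (c k * (((n - 2 * k : ℕ) : ℝ) * ((n - 2 * k - 1 : ℕ) : ℝ))) *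
        (X 0 ^ (n - 2 * k - 2) * axisDistSq m ^ k) := by
    have h : ∀ k, pderiv 0 (pderiv 0 (C (c k) * (X 0 ^ (n - 2 * k) * axisDistSq m ^ k)))
        = C (c k * (((n - 2 * k : ℕ) : ℝ) * ((n - 2 * k - 1 : ℕ) : ℝ))) *
          (X 0 ^ (n - 2 * k - 2) * axisDistSq m ^ k) := by
      intro k
      rw [pderiv_C_mul, pderiv_zero_mul_axisDistSq_pow, ← C_eq_coe_nat,
        pderiv_C_mul, pderiv_C_mul, pderiv_zero_mul_axisDistSq_pow, Nat.sub_sub _ 1 1]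
      simp only [C_mul, C_eq_coe_nat]
      ring
    simp only [axialForm, map_sum, h]
    rw [Finset.sum_range_succ, add_eq_left]
    -- the exponent of `x₀` in the last term is `0` or `1`
    have : n - 2 * (n / 2) = 0 ∨ n - 2 * (n / 2) - 1 = 0 := by omega
    rcases this with h | h <;> simp [h]
  have h1 : ∑ j : Fin m, pderiv j.succ (pderiv j.succ (axialForm m n c))
      = ∑ k ∈ Finset.range (n / 2), C (c (k + 1) * (2 * (k + 1) * (m + 2 * k))) *
        (X 0 ^ (n - 2 * k - 2) * axisDistSq m ^ k) := by
    simp only [axialForm, map_sum]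
    rw [Finset.sum_comm, Finset.sum_range_succ']
    refine (add_eq_left.2 ?_).trans ?_
    rotate_left
    · refine Finset.sum_congr rfl fun k _ => ?_
      simp only [pderiv_C_mul]
      rw [← Finset.mul_sum, sum_pderiv_succ_pderiv_succ,
        show n - 2 * (k + 1) = n - 2 * k - 2 by omega]
      simp only [C_mul, C_add, C_1, C_eq_coe_nat]
      rw [show (C 2 : MvPolynomial (Fin (m + 1)) ℝ) = 2 from map_ofNat C 2]
      ring
    · refine Finset.sum_eq_zero fun j _ => ?_
      rw [pderiv_C_mul, pderiv_succ_mul_axisDistSq_pow]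
      simp
  rw [polyLaplacian, Fin.sum_univ_succ, h0, h1, ← Finset.sum_add_distrib]
  refine Finset.sum_congr rfl fun k _ => ?_
  rw [C_add, add_mul]

/-! ### Invariance under the stabilizer of the pole -/

/-- The Householder reflection exchanging two vectors `x`, `y` of equal length fixes every vector
that pairs equally with them. -/
theorem exists_orthogonal_mulVec_eq {ι : Type*} [Fintype ι] [DecidableEq ι] {x y z : ι → ℝ}
    (hxy : dotProduct x x = dotProduct y y) (hz : dotProduct x z = dotProduct y z) :
    ∃ R ∈ Matrix.orthogonalGroup ι ℝ, R.mulVec z = z ∧ R.mulVec x = y := by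
  by_cases hv : dotProduct (x - y) (x - y) = 0
  · refine ⟨1, one_mem _, Matrix.one_mulVec z, ?_⟩
    rw [Matrix.one_mulVec]
    exact sub_eq_zero.1 (dotProduct_self_eq_zero.1 hv)
  set v := x - y with hvdef
  set a := 2 / dotProduct v v with ha
  have hav : a * dotProduct v v = 2 := by rw [ha]; field_simp
  have hmul : ∀ w, (1 - a • Matrix.vecMulVec v v).mulVec w = w - (a * dotProduct v w) • v := by
    intro w
    rw [Matrix.sub_mulVec, Matrix.one_mulVec, Matrix.smul_mulVec, Matrix.vecMulVec_mulVec]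
    ext i
    simp
    ring
  refine ⟨1 - a • Matrix.vecMulVec v v, ?_, ?_, ?_⟩
  · rw [Matrix.mem_orthogonalGroup_iff]
    have hT : (1 - a • Matrix.vecMulVec v v).transpose = 1 - a • Matrix.vecMulVec v v := by
      ext i j
      simp [Matrix.one_apply, Matrix.vecMulVec_apply, eq_comm, mul_comm (v i)]
    have hP : Matrix.vecMulVec v v * Matrix.vecMulVec v v
        = dotProduct v v • Matrix.vecMulVec v v := by
      rw [Matrix.vecMulVec_mul_vecMulVec]
      ext i j
      simp [Matrix.vecMulVec_apply]
      ring
    rw [hT]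
    simp only [mul_sub, sub_mul, one_mul, mul_one, smul_mul_assoc, mul_smul_comm, hP, smul_smul]
    rw [hav, smul_sub, smul_smul, mul_two, add_smul]
    abel
  · rw [hmul, hvdef, sub_dotProduct, hz]
    simp
  · have h : a * dotProduct v x = 1 := by
      have : dotProduct v v = 2 * dotProduct v x := by
        simp only [hvdef, sub_dotProduct, dotProduct_sub, hxy, dotProduct_comm y x]
        ring
      rw [this] at hav
      linarith
    rw [hmul, h, one_smul, hvdef, sub_sub_cancel]

theorem IsZonalHarmonic.eval_eq {m n : ℕ} {L : MvPolynomial (Fin (m + 1)) ℝ}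
    (hL : IsZonalHarmonic (m + 1) n L) {x y : Fin (m + 1) → ℝ} (h0 : x 0 = y 0)
    (hxy : dotProduct x x = dotProduct y y) :
    MvPolynomial.eval x L = MvPolynomial.eval y L := by
  obtain ⟨R, hR, hRz, hRx⟩ := exists_orthogonal_mulVec_eq (z := poleVec (m + 1)) hxy
    (by rw [dotProduct_poleVec, dotProduct_poleVec, h0])
  rw [← hL.invariant R hR hRz x, hRx]

theorem eval_smul_of_isHomogeneous {σ R : Type*} [CommSemiring R] {n : ℕ} {φ : MvPolynomial σ R}
    (hφ : φ.IsHomogeneous n) (a : R) (x : σ → R) :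
    MvPolynomial.eval (a • x) φ = a ^ n * MvPolynomial.eval x φ := by
  rw [MvPolynomial.eval_eq, MvPolynomial.eval_eq, Finset.mul_sum]
  refine Finset.sum_congr rfl fun d hd => ?_
  have hdeg : ∑ i ∈ d.support, d i = n := by
    rw [← hφ (MvPolynomial.mem_support_iff.1 hd), Finsupp.weight_apply]
    simp [Finsupp.sum]
  simp only [Pi.smul_apply, smul_eq_mul, mul_pow, Finset.prod_mul_distrib,
    Finset.prod_pow_eq_pow_sum, hdeg]
  ring

theorem coeff_odd_eq_zero_of_eval_neg {f : Polynomial ℝ} (hf : ∀ r, f.eval (-r) = f.eval r)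
    (k : ℕ) : f.coeff (2 * k + 1) = 0 := by
  have h : f.comp (-Polynomial.X) = f := Polynomial.funext fun r => by simpa using hf r
  have hc := congrArg (fun g => Polynomial.coeff g (2 * k + 1)) h
  rw [show -Polynomial.X = Polynomial.C (-1 : ℝ) * Polynomial.X by simp] at hc
  simp only [Polynomial.comp_C_mul_X_coeff, pow_succ, pow_mul] at hc
  norm_num at hc
  linarith

/-- A zonal harmonic is an axial form: its values are determined by those on the points
`(1, r, 0, …, 0)`, where it is an even polynomial in `r` of degree at most `n`. -/
theorem IsZonalHarmonic.exists_eq_axialForm {m n : ℕ} {L : MvPolynomial (Fin (m + 2)) ℝ}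
    (hL : IsZonalHarmonic (m + 2) n L) : ∃ c : ℕ → ℝ, L = axialForm (m + 1) n c := by
  set v : ℝ → Fin (m + 2) → ℝ := fun r => Fin.cons 1 (Fin.cons r 0) with hvdef
  have hv0 : ∀ r, v r 0 = 1 := fun r => rfl
  have hvv : ∀ r, dotProduct (v r) (v r) = 1 + r ^ 2 := fun r => by
    simp [hvdef, dotProduct, Fin.sum_univ_succ, pow_two]
  set w : Fin (m + 2) → Polynomial ℝ := Fin.cons 1 (Fin.cons Polynomial.X 0) with hw
  set f : Polynomial ℝ := MvPolynomial.aeval w L with hf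
  have hfe : ∀ r, f.eval r = MvPolynomial.eval (v r) L := by
    intro r
    have hwv : (fun i => (w i).eval r) = v r := by
      funext i
      refine Fin.cases ?_ (fun i => Fin.cases ?_ (fun i => ?_) i) i <;> simp [hw, hvdef]
    rw [hf, ← hwv, ← Polynomial.coe_aeval_eq_eval, MvPolynomial.comp_aeval_apply,
      MvPolynomial.aeval_eq_eval]
  have hdeg : f.natDegree < n + 1 := by
    have := MvPolynomial.aeval_natDegree_le L hL.homogeneous.totalDegree_le w (n := 1) (by
      intro i
      refine Fin.cases ?_ (fun i => Fin.cases ?_ (fun i => ?_) i) i <;> simp [hw])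
    exact this.trans_lt (by omega)
  have hodd : ∀ k, f.coeff (2 * k + 1) = 0 := coeff_odd_eq_zero_of_eval_neg fun r => by
    rw [hfe, hfe]
    exact hL.eval_eq rfl (by rw [hvv, hvv, neg_sq])
  refine ⟨fun k => f.coeff (2 * k), ?_⟩
  -- compare the values at the points off the hyperplane `x₀ = 0`
  have hX : (MvPolynomial.X 0 : MvPolynomial (Fin (m + 2)) ℝ) ≠ 0 := MvPolynomial.X_ne_zero 0
  refine mul_left_cancel₀ hX (MvPolynomial.funext fun x => ?_)
  rw [map_mul, map_mul, MvPolynomial.eval_X]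
  rcases eq_or_ne (x 0) 0 with hx | hx
  · rw [hx, zero_mul, zero_mul]
  congr 1
  have hD : 0 ≤ dotProduct x x - x 0 ^ 2 := by
    rw [← eval_axisDistSq]
    simp only [axisDistSq, map_sum, map_pow]
    positivity
  set r := √(dotProduct x x - x 0 ^ 2) / x 0 with hr
  have hr2 : r ^ 2 = (dotProduct x x - x 0 ^ 2) / x 0 ^ 2 := by
    rw [hr, div_pow, Real.sq_sqrt hD]
  have hLx : MvPolynomial.eval x L = x 0 ^ n * f.eval r := by
    rw [hfe, ← eval_smul_of_isHomogeneous hL.homogeneous]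
    refine hL.eval_eq (by simp [hv0]) ?_
    rw [smul_dotProduct, dotProduct_smul, hvv, hr2, smul_eq_mul, smul_eq_mul]
    field_simp
    ring
  rw [hLx, eval_axialForm, Polynomial.eval_eq_sum_range' hdeg,
    sum_range_eq_sum_even _ (fun k => by rw [hodd, zero_mul]), Finset.mul_sum]
  refine Finset.sum_congr rfl fun k hk => ?_
  have hk' : 2 * k ≤ n := by rw [Finset.mem_range] at hk; omega
  rw [pow_mul, hr2, div_pow, ← pow_mul, pow_sub₀ _ hx hk']
  field_simp

/-! ### Existence, uniqueness and the integral formula -/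

theorem eval_poleVec_axialForm {m n : ℕ} {c : ℕ → ℝ} :
    MvPolynomial.eval (poleVec (m + 1)) (axialForm m n c) = c 0 := by
  have h : dotProduct (poleVec (m + 1)) (poleVec (m + 1)) - poleVec (m + 1) 0 ^ 2 = 0 := by
    rw [dotProduct_poleVec]
    simp [poleVec]
  rw [eval_axialForm, h, Finset.sum_range_succ', Finset.sum_eq_zero fun k _ => by simp]
  simp [poleVec]

/-- Harmonicity determines the coefficients recursively: the terms of the Laplacian are linearly
independent. -/
theorem coeff_succ_of_polyLaplacian_eq_zero {m n : ℕ} {c : ℕ → ℝ}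
    (h : polyLaplacian (m + 2) (axialForm (m + 1) n c) = 0) {k : ℕ} (hk : k < n / 2) :
    c k * (((n - 2 * k : ℕ) : ℝ) * ((n - 2 * k - 1 : ℕ) : ℝ))
      + c (k + 1) * (2 * (k + 1) * (m + 1 + 2 * k)) = 0 := by
  set d : ℕ → ℝ := fun k => c k * (((n - 2 * k : ℕ) : ℝ) * ((n - 2 * k - 1 : ℕ) : ℝ))
      + c (k + 1) * (2 * (k + 1) * ((m + 1 : ℕ) + 2 * k)) with hd
  have hL := polyLaplacian_axialForm (m + 1) n c
  set g : Polynomial ℝ := ∑ k ∈ Finset.range (n / 2), Polynomial.C (d k) * Polynomial.X ^ k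
    with hg
  have hz : g = 0 := by
    refine Polynomial.eq_zero_of_infinite_isRoot g ((Set.Ici_infinite (0 : ℝ)).mono fun s hs => ?_)
    -- evaluate the Laplacian at `(1, √s, 0, …, 0)`
    have he := congrArg (MvPolynomial.eval
      (Fin.cons 1 (Fin.cons √s 0) : Fin (m + 2) → ℝ)) (hL.symm.trans h)
    have hD : dotProduct (Fin.cons 1 (Fin.cons √s 0) : Fin (m + 2) → ℝ)
        (Fin.cons 1 (Fin.cons √s 0)) - 1 = s := by
      simp [dotProduct, Fin.sum_univ_succ, Real.mul_self_sqrt (show 0 ≤ s from hs)]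
    simp only [map_sum, map_mul, map_pow, MvPolynomial.eval_C, MvPolynomial.eval_X,
      eval_axisDistSq, Fin.cons_zero, one_pow, hD, one_mul, map_zero] at he
    simpa [hg, hd, Polynomial.IsRoot, Polynomial.eval_finsetSum] using he
  have hck : g.coeff k = d k := by
    simp [hg, Polynomial.coeff_X_pow, hk]
  rw [hz, Polynomial.coeff_zero] at hck
  rw [hck, hd]
  push_cast
  ring

theorem IsZonalHarmonic.eq_axialForm_zonalCoeff {q n : ℕ} {L : MvPolynomial (Fin (q + 3)) ℝ}
    (hL : IsZonalHarmonic (q + 3) n L) : L = axialForm (q + 2) n (zonalCoeff q n) := by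
  obtain ⟨c, rfl⟩ := hL.exists_eq_axialForm
  have hc : ∀ k, k ≤ n / 2 → c k = zonalCoeff q n k := by
    intro k
    induction k with
    | zero =>
      intro _
      rw [zonalCoeff_zero, ← hL.eval_pole, eval_poleVec_axialForm]
    | succ k ih =>
      intro hk
      have h1 := coeff_succ_of_polyLaplacian_eq_zero hL.harmonic (Nat.lt_of_succ_le hk)
      have h2 := zonalCoeff_succ q n k
      rw [ih (by omega)] at h1
      push_cast at h1
      have hpos : (0 : ℝ) < 2 * (k + 1) * (q + 2 + 2 * k) := by positivity
      refine mul_right_cancel₀ hpos.ne' ?_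
      linarith
  refine Finset.sum_congr rfl fun k hk => ?_
  rw [hc k (Nat.lt_succ_iff.1 (Finset.mem_range.1 hk))]

theorem isZonalHarmonic_axialForm (q n : ℕ) :
    IsZonalHarmonic (q + 3) n (axialForm (q + 2) n (zonalCoeff q n)) where
  homogeneous := isHomogeneous_axialForm _ _ _
  harmonic := by
    rw [polyLaplacian_axialForm]
    refine Finset.sum_eq_zero fun k _ => ?_
    have h := zonalCoeff_succ q n k
    push_cast
    rw [h, map_zero, zero_mul]
  eval_pole := by rw [eval_poleVec_axialForm, zonalCoeff_zero]
  invariant := by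
    intro R hR hη x
    have hRR : R.transpose * R = 1 := (Matrix.mem_orthogonalGroup_iff' _ _).1 hR
    have hdot : ∀ y z, dotProduct (R.mulVec y) (R.mulVec z) = dotProduct y z := fun y z => by
      rw [Matrix.dotProduct_mulVec, Matrix.vecMul_mulVec, ← Matrix.dotProduct_mulVec, hRR,
        Matrix.one_mulVec]
    have h0 : R.mulVec x 0 = x 0 := by
      rw [← dotProduct_poleVec x, ← dotProduct_poleVec (R.mulVec x)]
      nth_rewrite 1 [← hη]
      exact hdot _ _
    rw [eval_axialForm, eval_axialForm, hdot, h0]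

open Polynomial in
/-- The Legendre polynomial of degree `n` in dimension `q + 3`. -/
noncomputable def legendrePoly (q n : ℕ) : ℝ[X] :=
  ∑ k ∈ Finset.range (n / 2 + 1), C (zonalCoeff q n k) * X ^ (n - 2 * k) * (1 - X ^ 2) ^ k

theorem eval_legendrePoly (q n : ℕ) (t : ℝ) : (legendrePoly q n).eval t =
    ∑ k ∈ Finset.range (n / 2 + 1), zonalCoeff q n k * t ^ (n - 2 * k) * (1 - t ^ 2) ^ k := by
  simp [legendrePoly, Polynomial.eval_finsetSum]

theorem eval_axialForm_of_dotProduct_self_eq_one {q n : ℕ} {ξ : Fin (q + 3) → ℝ}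
    (hξ : dotProduct ξ ξ = 1) : MvPolynomial.eval ξ (axialForm (q + 2) n (zonalCoeff q n))
      = (legendrePoly q n).eval (dotProduct ξ (poleVec (q + 3))) := by
  rw [dotProduct_poleVec, eval_axialForm, hξ, eval_legendrePoly]
  exact Finset.sum_congr rfl fun k _ => (mul_assoc _ _ _).symm

theorem isLegendrePolynomial_legendrePoly (q n : ℕ) :
    IsLegendrePolynomial (q + 3) n (legendrePoly q n) :=
  ⟨_, isZonalHarmonic_axialForm q n, fun _ hξ => eval_axialForm_of_dotProduct_self_eq_one hξ⟩

theorem IsLegendrePolynomial.eq_legendrePoly {q n : ℕ} {P : Polynomial ℝ}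
    (hP : IsLegendrePolynomial (q + 3) n P) : P = legendrePoly q n := by
  obtain ⟨L, hL, hPL⟩ := hP
  obtain rfl := hL.eq_axialForm_zonalCoeff
  refine Polynomial.eq_of_infinite_eval_eq P _
    ((Set.Icc_infinite (show (-1 : ℝ) < 1 by norm_num)).mono fun t ht => ?_)
  -- every `t ∈ [-1, 1]` is the height of the point `(t, √(1 - t²), 0, …, 0)` of the sphere
  have hξ : dotProduct (Fin.cons t (Fin.cons √(1 - t ^ 2) 0) : Fin (q + 3) → ℝ)
      (Fin.cons t (Fin.cons √(1 - t ^ 2) 0)) = 1 := by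
    have : 0 ≤ 1 - t ^ 2 := by nlinarith [ht.1, ht.2]
    simp [dotProduct, Fin.sum_univ_succ, ← pow_two, Real.sq_sqrt this]
  have h := (hPL _ hξ).symm.trans (eval_axialForm_of_dotProduct_self_eq_one hξ)
  rwa [dotProduct_poleVec, Fin.cons_zero] at h

theorem mainTheorem10 (p n : ℕ) (hp : 3 ≤ p) :
    (∃! P : Polynomial ℝ, IsLegendrePolynomial p n P) ∧
    ∀ P : Polynomial ℝ, IsLegendrePolynomial p n P →
      ∀ t ∈ Set.Icc (-1 : ℝ) 1,
        IntervalIntegrable (laplaceIntegrand p n t) volume (-1) 1 ∧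
        ((P.eval t : ℝ) : ℂ) =
          ((sphereArea (p - 3) / sphereArea (p - 2) : ℝ) : ℂ) *
            ∫ s in (-1 : ℝ)..1, laplaceIntegrand p n t s := by
  obtain ⟨q, rfl⟩ := Nat.exists_eq_add_of_le' hp
  refine ⟨⟨_, isLegendrePolynomial_legendrePoly q n, fun P hP => hP.eq_legendrePoly⟩, ?_⟩
  intro P hP t ht
  obtain rfl := hP.eq_legendrePoly
  refine ⟨intervalIntegrable_laplaceIntegrand q n t, ?_⟩
  have hΩ := (sphereArea_pos q).ne'
  have hM := (trigMoment_zero_pos q).ne'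
  rw [integral_laplaceIntegrand, integral_trigIntegrand q n ht, ← eval_legendrePoly,
    ← Complex.ofReal_mul, show q + 3 - 3 = q by omega, show q + 3 - 2 = q + 1 by omega,
    sphereArea_succ]
  congr 1
  field_simp
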